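/- **Proposition (pentagon signature and hexagon graph of a fullerene).** A fullerene isomer of $C_n$ is a compact three-dimensional convex polytope $P\subset\mathbb{R}^3$ with $n$ vertices which is simple (every vertex lies on exactly three edges) and whose facets are 12 pentagons and $n/2-10$ hexagons (facets with exactly five, respectively six, edges). Its dual facet graph has the facets of $P$ as vertices, two different facets being adjacent if they share an edge of $P$. Let $T_n^6$ be its subgraph induced by the hexagonal facets, $A_n^6$ the adjacency matrix of $T_n^6$, and $N(A_n^6,2)=\operatorname{tr}\big((A_n^6)^2\big)$ its Newton polynomial of degree 2. For $i=1,\dots,5$ let $p_i$ be the number of pentagonal facets that are adjacent to exactly $i$ other pentagonal facets, and let $P_1=\frac12\sum_{i=1}^5 i\,p_i$ be the Fowler–Manolopoulos pentagon signature. Then for every fullerene isomer of $C_n$ $$P_1=\frac{N(A_n^6,2)}{2}-\frac{3n}{2}+60 .$$ In particular $N(A_n^6,2)=2P_1+3n-120$, so for fixed $n$ the Newton polynomial of degree 2 of the hexagon graph is an affine function of the pentagon signature. -/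

import Mathlib

noncomputable section

namespace Fullerene

/-- Three-dimensional Euclidean space. -/
abbrev Space := EuclideanSpace ℝ (Fin 3)

/-- The affine dimension of a subset of three-dimensional space. -/
def affineDim (S : Set Space) : ℕ := Module.finrank ℝ (vectorSpan ℝ S)

/-- The intersection of the half-spaces `⟪a i, x⟫ + b i ≥ 0`. -/
def halfspaceInter {m : ℕ} (a : Fin m → Space) (b : Fin m → ℝ) : Set Space :=
  {x | ∀ i, 0 ≤ inner ℝ (a i) x + b i}

/-- The part of the intersection of half-spaces that lies in the `i`-th bounding plane. -/
def boundaryPart {m : ℕ} (a : Fin m → Space) (b : Fin m → ℝ) (i : Fin m) : Set Space :=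
  {x | inner ℝ (a i) x + b i = 0} ∩ halfspaceInter a b

/-- A compact three-dimensional convex polytope with exactly `m` facets, presented by its
facet inequalities: each inequality defines a two-dimensional facet, and different inequalities
define different facets. -/
structure Polytope (m : ℕ) where
  /-- the normal vectors of the facet planes -/
  a : Fin m → Space
  /-- the offsets of the facet planes -/
  b : Fin m → ℝ
  a_ne_zero : ∀ i, a i ≠ 0
  isCompact : IsCompact (halfspaceInter a b)
  interior_nonempty : (interior (halfspaceInter a b)).Nonempty
  dim_facet : ∀ i, affineDim (boundaryPart a b i) = 2
  facet_injective : Function.Injective (boundaryPart a b)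

namespace Polytope

variable {m : ℕ} (P : Polytope m)

/-- The polytope as a set of points. -/
def carrier : Set Space := halfspaceInter P.a P.b

/-- The `i`-th facet. -/
def facet (i : Fin m) : Set Space := boundaryPart P.a P.b i

/-- The vertices of the polytope. -/
def vertices : Set Space := P.carrier.extremePoints ℝ

/-- The edges of the polytope: its one-dimensional faces, where a face is the set of all points of
the polytope at which some linear functional is maximal. -/
def edges : Set (Set Space) := {e | IsExposed ℝ P.carrier e ∧ affineDim e = 1}

/-- The polytope is simple: every vertex lies on exactly three edges. -/
def IsSimple : Prop := ∀ v ∈ P.vertices, {e ∈ P.edges | v ∈ e}.ncard = 3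

/-- The `i`-th facet is a `k`-gon: it has exactly `k` edges. -/
def IsGon (k : ℕ) (i : Fin m) : Prop := {e ∈ P.edges | e ⊆ P.facet i}.ncard = k

/-- The set of (indices of) pentagonal facets. -/
def pentagons : Set (Fin m) := {i | P.IsGon 5 i}

/-- The set of (indices of) hexagonal facets. -/
def hexagons : Set (Fin m) := {i | P.IsGon 6 i}

/-- The dual facet graph: two different facets are adjacent if they share an edge. -/
def dualGraph : SimpleGraph (Fin m) where
  Adj i j := i ≠ j ∧ ∃ e ∈ P.edges, e ⊆ P.facet i ∧ e ⊆ P.facet j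
  symm := ⟨fun _ _ ⟨h, e, he, hi, hj⟩ => ⟨h.symm, e, he, hj, hi⟩⟩
  loopless := ⟨fun _ h => h.1 rfl⟩

/-- The subgraph of the dual facet graph induced by the pentagons. -/
def pentagonGraph : SimpleGraph P.pentagons := P.dualGraph.induce P.pentagons

/-- The subgraph of the dual facet graph induced by the hexagons. -/
def hexagonGraph : SimpleGraph P.hexagons := P.dualGraph.induce P.hexagons

open Classical in
/-- The adjacency matrix of the graph of hexagonal facets. -/
def hexagonMatrix : Matrix P.hexagons P.hexagons ℝ := P.hexagonGraph.adjMatrix ℝ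

/-- The pentagon index `p_i`: the number of pentagons adjacent to exactly `i` other pentagons. -/
def pentagonIndex (i : ℕ) : ℕ :=
  {f : P.pentagons | (P.pentagonGraph.neighborSet f).ncard = i}.ncard

/-- The pentagon signature `P₁ = ½ ∑_{i=1}^5 i p_i`. -/
def pentagonSignature : ℝ := 1 / 2 * ∑ i ∈ Finset.Icc (1 : ℕ) 5, (i : ℝ) * P.pentagonIndex i

/-- `P` is a fullerene isomer in `C_n`: a simple polytope with `n` vertices whose facets are
12 pentagons and `n / 2 - 10` hexagons (so `n` is even). -/
structure IsFullerene (n : ℕ) : Prop where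
  isSimple : P.IsSimple
  card_vertices : P.vertices.ncard = n
  pentagon_or_hexagon : ∀ i, i ∈ P.pentagons ∨ i ∈ P.hexagons
  card_pentagons : P.pentagons.ncard = 12
  card_hexagons : (P.hexagons.ncard : ℚ) = n / 2 - 10

end Polytope

open Classical in
/-- The Newton polynomial `N(A, k) = tr (A ^ k)`. -/
def newton {V : Type*} [Fintype V] (A : Matrix V V ℝ) (k : ℕ) : ℝ := (A ^ k).trace

end Fullerene

end

/-! Double counting of ordered adjacent pairs in the dual graph. Write pp, ph, hp, hh for the counts
by type (pentagon or hexagon). A k-gon has exactly k neighbours (`ncard_neighborSet`), so pp + ph =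
12·5 and hh + hp = 6(n/2 - 10), while ph = hp by symmetry. Hence hh = pp + 3n - 120, where hh is the
trace of the squared hexagon matrix and pp is twice the signature.

The geometric content is that neighbours of a facet correspond to its edges: two facets share at
most one edge (`eq_inter_facet`), and an edge of a facet lies in exactly one other facet
(`exists_facet_of_edge`, `facet_unique_of_edge`). -/

namespace Fullerene

/-- Two vectors orthogonal to `u` which span a plane have common orthogonal complement `ℝ u`. -/
lemma mem_span_of_orthogonal {u a b z : Space} (hu : u ≠ 0) (hau : inner ℝ a u = 0)
    (hbu : inner ℝ b u = 0) (hab : LinearIndependent ℝ ![a, b])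
    (haz : inner ℝ a z = 0) (hbz : inner ℝ b z = 0) : z ∈ Submodule.span ℝ {u} := by
  have h3 : Module.finrank ℝ Space = 3 := by simp
  have hW := finrank_span_eq_card hab
  rw [Matrix.range_cons_cons_empty, Fintype.card_fin] at hW
  set W := Submodule.span ℝ {a, b}
  have hWo : ∀ v : Space, inner ℝ a v = 0 → inner ℝ b v = 0 → v ∈ Wᗮ := by
    intro v ha hb
    rw [Submodule.mem_orthogonal]
    intro w hw
    obtain ⟨s, t, rfl⟩ := Submodule.mem_span_pair.1 hw
    simp [inner_add_left, inner_smul_left, ha, hb]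
  have hle : Submodule.span ℝ {u} ≤ Wᗮ := by
    rw [Submodule.span_singleton_le_iff_mem]
    exact hWo u hau hbu
  have hd := Submodule.finrank_add_finrank_orthogonal W
  have heq := Submodule.eq_of_le_of_finrank_eq hle (by rw [finrank_span_singleton hu]; omega)
  rw [heq]
  exact hWo z haz hbz

/-- Three vectors orthogonal to `u`, the first two of them independent, are dependent. -/
lemma exists_eq_add_of_orthogonal {u a b c : Space} (hu : u ≠ 0) (hau : inner ℝ a u = 0)
    (hbu : inner ℝ b u = 0) (hcu : inner ℝ c u = 0) (hab : LinearIndependent ℝ ![a, b]) :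
    ∃ s t : ℝ, s • a + t • b = c := by
  have h3 : Module.finrank ℝ Space = 3 := by simp
  have hW := finrank_span_eq_card hab
  rw [Matrix.range_cons_cons_empty, Fintype.card_fin] at hW
  have hmem : ∀ v : Space, inner ℝ v u = 0 → v ∈ (Submodule.span ℝ {u})ᗮ := fun v hv =>
    Submodule.mem_orthogonal_singleton_iff_inner_left.2 hv
  have hle : Submodule.span ℝ {a, b} ≤ (Submodule.span ℝ {u})ᗮ := by
    rw [Submodule.span_le, Set.insert_subset_iff, Set.singleton_subset_iff]
    exact ⟨hmem a hau, hmem b hbu⟩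
  have hd := Submodule.finrank_add_finrank_orthogonal (Submodule.span ℝ {u})
  rw [finrank_span_singleton hu] at hd
  have heq := Submodule.eq_of_le_of_finrank_eq hle (by omega)
  exact Submodule.mem_span_pair.1 (heq ▸ hmem c hcu)

lemma exists_sub_notMem_span {S : Set Space} {x u : Space} (hx : x ∈ S) (hS : affineDim S = 2) :
    ∃ y ∈ S, y - x ∉ Submodule.span ℝ {u} := by
  by_contra! h
  have hle : vectorSpan ℝ S ≤ Submodule.span ℝ {u} := by
    rw [vectorSpan_eq_span_vsub_set_right ℝ hx, Submodule.span_le]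
    rintro _ ⟨y, hy, rfl⟩
    exact h y hy
  have h1 := Submodule.finrank_mono hle
  have h2 := finrank_span_le_card (R := ℝ) ({u} : Set Space)
  simp only [Set.toFinset_singleton, Finset.card_singleton] at h2
  rw [affineDim] at hS
  omega

/-! ### Incidence of edges and facets -/

namespace Polytope

variable {m : ℕ} (P : Polytope m)

lemma exists_pos : ∃ c : Space, ∀ i, 0 < inner ℝ (P.a i) c + P.b i := by
  obtain ⟨c, hc⟩ := P.interior_nonempty
  refine ⟨c, fun i => ?_⟩
  have hcont : Filter.Tendsto (fun t : ℝ => c - t • P.a i) (nhds 0) (nhds c) := by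
    have : Continuous fun t : ℝ => c - t • P.a i := by fun_prop
    simpa using this.tendsto 0
  obtain ⟨ε, hε, h⟩ := Metric.eventually_nhds_iff.1
    (hcont.eventually (mem_interior_iff_mem_nhds.1 hc))
  have hmem : 0 ≤ inner ℝ (P.a i) (c - (ε / 2) • P.a i) + P.b i :=
    h (by rw [Real.dist_eq, sub_zero, abs_of_pos (half_pos hε)]; exact half_lt_self hε) i
  rw [inner_sub_right, inner_smul_right] at hmem
  have := mul_pos (half_pos hε) (real_inner_self_pos.2 (P.a_ne_zero i))
  linarith

variable {P}

/-- An edge has a direction `u` and a point `x` in its relative interior: the facet planes through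
`x` contain the edge. -/
lemma exists_direction {e : Set Space} (he : e ∈ P.edges) :
    ∃ x ∈ e, ∃ u : Space, u ≠ 0 ∧ vectorSpan ℝ e = Submodule.span ℝ {u} ∧
      ∀ i, inner ℝ (P.a i) x + P.b i = 0 → e ⊆ P.facet i ∧ inner ℝ (P.a i) u = 0 := by
  obtain ⟨hexp, hdim⟩ := he
  have hnt : e.Nontrivial := by
    by_contra h
    rw [affineDim, (vectorSpan_eq_bot_iff_subsingleton (k := ℝ) (s := e)).2
      (Set.not_nontrivial_iff.1 h), finrank_bot] at hdim
    exact zero_ne_one hdim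
  obtain ⟨p, hp, q, hq, hpq⟩ := hnt
  have hsub : e ⊆ P.carrier := hexp.subset
  have hC : Convex ℝ P.carrier := by
    intro y hy z hz s t hs ht hst i
    have h1 := mul_nonneg hs (hy i)
    have h2 := mul_nonneg ht (hz i)
    rw [inner_add_right, inner_smul_right, inner_smul_right]
    have h3 : P.b i = (s + t) * P.b i := by rw [hst, one_mul]
    linarith
  -- An affine function nonnegative at `p` and `q` that vanishes at their midpoint vanishes at both,
  -- hence on the whole line.
  have hmid : midpoint ℝ p q ∈ e := (hexp.convex hC).midpoint_mem hp hq
  have hu : q - p ≠ 0 := sub_ne_zero.2 hpq.symm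
  have hspan : vectorSpan ℝ e = Submodule.span ℝ {q - p} := by
    symm
    apply Submodule.eq_of_le_of_finrank_eq
    · rw [Submodule.span_singleton_le_iff_mem]
      exact vsub_mem_vectorSpan ℝ hq hp
    · rw [finrank_span_singleton hu]
      exact hdim.symm
  refine ⟨_, hmid, q - p, hu, hspan, fun i hi => ?_⟩
  have h1 : 0 ≤ inner ℝ (P.a i) p + P.b i := hsub hp i
  have h2 : 0 ≤ inner ℝ (P.a i) q + P.b i := hsub hq i
  rw [midpoint_eq_smul_add, inner_smul_right, inner_add_right, invOf_eq_inv] at hi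
  have h0 : inner ℝ (P.a i) (q - p) = 0 := by
    rw [inner_sub_right]; linarith
  refine ⟨fun z hz => ⟨?_, hsub hz⟩, h0⟩
  have hzp : z - p ∈ Submodule.span ℝ {q - p} := hspan ▸ vsub_mem_vectorSpan ℝ hz hp
  obtain ⟨t, ht⟩ := Submodule.mem_span_singleton.1 hzp
  have : inner ℝ (P.a i) (z - p) = 0 := by rw [← ht, inner_smul_right, h0, mul_zero]
  rw [inner_sub_right] at this
  show inner ℝ (P.a i) z + P.b i = 0
  linarith

/-- The normal vectors of two different facets with a common point are linearly independent. -/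
lemma linearIndependent_normals {i j : Fin m} (hij : i ≠ j) {x : Space} (hi : x ∈ P.facet i)
    (hj : x ∈ P.facet j) : LinearIndependent ℝ ![P.a i, P.a j] := by
  rw [LinearIndependent.pair_iff' (P.a_ne_zero i)]
  intro s hs
  have hxi : inner ℝ (P.a i) x + P.b i = 0 := hi.1
  have hxj : inner ℝ (P.a j) x + P.b j = 0 := hj.1
  have key : ∀ z, inner ℝ (P.a j) z + P.b j = s * (inner ℝ (P.a i) z + P.b i) := by
    intro z
    rw [← hs, real_inner_smul_left] at hxj ⊢
    linear_combination hxj - s * hxi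
  obtain ⟨c, hc⟩ := P.exists_pos
  have hs0 : s ≠ 0 := by
    rintro rfl
    have := hc j
    rw [key c, zero_mul] at this
    exact lt_irrefl _ this
  refine hij (P.facet_injective ?_)
  ext z
  refine and_congr_left fun _ => ?_
  show inner ℝ (P.a i) z + P.b i = 0 ↔ inner ℝ (P.a j) z + P.b j = 0
  simp [key z, hs0]

/-- The two facet planes meet in the line of `e`. The functional exposing `e` is constant on that
line, so every point of the polytope on it is again a maximizer. -/
lemma eq_inter_facet {e : Set Space} (he : e ∈ P.edges) {i j : Fin m} (hij : i ≠ j)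
    (hi : e ⊆ P.facet i) (hj : e ⊆ P.facet j) : e = P.facet i ∩ P.facet j := by
  refine (Set.subset_inter hi hj).antisymm ?_
  rintro z ⟨hzi, hzj⟩
  obtain ⟨x, hx, u, hu, hspan, hact⟩ := exists_direction he
  have hind := linearIndependent_normals hij (hi hx) (hj hx)
  have hxi : inner ℝ (P.a i) x + P.b i = 0 := (hi hx).1
  have hxj : inner ℝ (P.a j) x + P.b j = 0 := (hj hx).1
  have hzi' : inner ℝ (P.a i) z + P.b i = 0 := hzi.1
  have hzj' : inner ℝ (P.a j) z + P.b j = 0 := hzj.1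
  have hz : z - x ∈ vectorSpan ℝ e := by
    rw [hspan]
    refine mem_span_of_orthogonal hu (hact i hxi).2 (hact j hxj).2 hind ?_ ?_ <;>
      rw [inner_sub_right] <;> linarith
  obtain ⟨l, hl⟩ := he.1 ⟨x, hx⟩
  have hconst : ∀ y ∈ e, l y = l x := by
    intro y hy
    rw [hl] at hx hy
    exact le_antisymm (hx.2 y hy.1) (hy.2 x hx.1)
  have hlz : l (z - x) = 0 := by
    have hle : vectorSpan ℝ e ≤ LinearMap.ker (l : Space →ₗ[ℝ] ℝ) := by
      rw [vectorSpan_eq_span_vsub_set_right ℝ hx, Submodule.span_le]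
      rintro _ ⟨y, hy, rfl⟩
      simp [hconst y hy]
    exact hle hz
  rw [map_sub, sub_eq_zero] at hlz
  rw [hl] at hx ⊢
  exact ⟨hzi.2, fun y hy => hlz ▸ hx.2 y hy⟩

/-- An edge of a facet lies in a second facet. -/
lemma exists_facet_of_edge {e : Set Space} (he : e ∈ P.edges) {i : Fin m} (hi : e ⊆ P.facet i) :
    ∃ j, i ≠ j ∧ e ⊆ P.facet j := by
  by_contra! h
  obtain ⟨x, hx, u, hu, hspan, hact⟩ := exists_direction he
  have hxi : inner ℝ (P.a i) x + P.b i = 0 := (hi hx).1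
  obtain ⟨y, hy, hyu⟩ := exists_sub_notMem_span (u := u) (hi hx) (P.dim_facet i)
  have hyi : inner ℝ (P.a i) y + P.b i = 0 := hy.1
  have hw : inner ℝ (P.a i) (y - x) = 0 := by rw [inner_sub_right]; linarith
  -- Only the `i`-th inequality is tight at `x`, so one can move both ways along `y - x` inside the
  -- polytope; the exposing functional is then constant in that direction, and `e` would leave its
  -- line.
  have hev : ∀ᶠ t : ℝ in nhds 0, x + t • (y - x) ∈ P.carrier := by
    refine Filter.eventually_all.2 fun k => ?_
    by_cases hk : inner ℝ (P.a k) x + P.b k = 0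
    · have hik : i = k := by
        by_contra hne
        exact h k hne (hact k hk).1
      subst hik
      refine Filter.Eventually.of_forall fun t => ?_
      rw [inner_add_right, inner_smul_right, hw]
      linarith
    · have hpos : 0 < inner ℝ (P.a k) x + P.b k := lt_of_le_of_ne ((hi hx).2 k) (Ne.symm hk)
      have hc : Continuous fun t : ℝ => inner ℝ (P.a k) (x + t • (y - x)) + P.b k := by fun_prop
      have ht := hc.tendsto 0
      simp only [zero_smul, add_zero] at ht
      exact (ht.eventually_const_lt hpos).mono fun t ht => ht.le
  obtain ⟨ε, hε, hball⟩ := Metric.eventually_nhds_iff.1 hev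
  have h1 : x + (ε / 2) • (y - x) ∈ P.carrier :=
    hball (by rw [Real.dist_eq, sub_zero, abs_of_pos (half_pos hε)]; exact half_lt_self hε)
  have h2 : x + (-(ε / 2)) • (y - x) ∈ P.carrier :=
    hball (by rw [Real.dist_eq, sub_zero, abs_neg, abs_of_pos (half_pos hε)]
              exact half_lt_self hε)
  obtain ⟨l, hl⟩ := he.1 ⟨x, hx⟩
  have hx' := hx
  rw [hl] at hx'
  have h3 := hx'.2 _ h1
  have h4 := hx'.2 _ h2
  simp only [map_add, map_smul, smul_eq_mul] at h3 h4
  have hmem : x + (ε / 2) • (y - x) ∈ e := by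
    rw [hl]
    refine ⟨h1, fun z hz => (hx'.2 z hz).trans ?_⟩
    simp only [map_add, map_smul, smul_eq_mul]
    linarith
  have h5 : (ε / 2) • (y - x) ∈ Submodule.span ℝ {u} := by
    have := vsub_mem_vectorSpan ℝ hmem hx
    rwa [hspan, vsub_eq_sub, add_sub_cancel_left] at this
  exact hyu ((Submodule.smul_mem_iff _ (half_pos hε).ne').1 h5)

/-- At most two facets contain a given edge. -/
lemma facet_unique_of_edge {e : Set Space} (he : e ∈ P.edges) {i j k : Fin m} (hij : i ≠ j)
    (hik : i ≠ k) (hi : e ⊆ P.facet i) (hj : e ⊆ P.facet j) (hk : e ⊆ P.facet k) : j = k := by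
  by_contra hjk
  obtain ⟨x, hx, u, hu, hspan, hact⟩ := exists_direction he
  have hortho : ∀ l, e ⊆ P.facet l → inner ℝ (P.a l) u = 0 := fun l hl => (hact l (hl hx).1).2
  -- Each facet `l` through `e` yields a direction along it that points strictly inward for every
  -- other facet through `e`.
  have hray : ∀ l, e ⊆ P.facet l → ∃ w : Space, inner ℝ (P.a l) w = 0 ∧
      ∀ l', e ⊆ P.facet l' → l ≠ l' → 0 < inner ℝ (P.a l') w := by
    intro l hl
    obtain ⟨y, hy, hyu⟩ := exists_sub_notMem_span (u := u) (hl hx) (P.dim_facet l)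
    have hxl : inner ℝ (P.a l) x + P.b l = 0 := (hl hx).1
    have hyl : inner ℝ (P.a l) y + P.b l = 0 := hy.1
    have hw : inner ℝ (P.a l) (y - x) = 0 := by rw [inner_sub_right]; linarith
    refine ⟨y - x, hw, fun l' hl' hne => lt_of_le_of_ne ?_ fun h0 => ?_⟩
    · have h1 : inner ℝ (P.a l') x + P.b l' = 0 := (hl' hx).1
      have h2 : 0 ≤ inner ℝ (P.a l') y + P.b l' := hy.2 l'
      rw [inner_sub_right]
      linarith
    · exact hyu (mem_span_of_orthogonal hu (hortho l hl) (hortho l' hl')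
        (linearIndependent_normals hne (hl hx) (hl' hx)) hw h0.symm)
  -- The three normals lie in the plane orthogonal to `u`. Testing the relation on `wi` and `wj`
  -- forces `t` and `s` positive; on `wk` it then equates zero with a positive number.
  obtain ⟨s, t, hst⟩ := exists_eq_add_of_orthogonal hu (hortho i hi) (hortho j hj) (hortho k hk)
    (linearIndependent_normals hij (hi hx) (hj hx))
  have hev : ∀ w, inner ℝ (P.a k) w = s * inner ℝ (P.a i) w + t * inner ℝ (P.a j) w := by
    intro w
    rw [← hst, inner_add_left, real_inner_smul_left, real_inner_smul_left]
  obtain ⟨wi, hwi, hi'⟩ := hray i hi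
  obtain ⟨wj, hwj, hj'⟩ := hray j hj
  obtain ⟨wk, hwk, hk'⟩ := hray k hk
  have ht : 0 < t := by
    have h1 := hev wi
    rw [hwi, mul_zero, zero_add] at h1
    exact pos_of_mul_pos_left (h1 ▸ hi' k hk hik) (hi' j hj hij).le
  have hs : 0 < s := by
    have h1 := hev wj
    rw [hwj, mul_zero, add_zero] at h1
    exact pos_of_mul_pos_left (h1 ▸ hj' k hk hjk) (hj' i hi hij.symm).le
  have h1 := mul_pos hs (hk' i hi hik.symm)
  have h2 := mul_pos ht (hk' j hj (Ne.symm hjk))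
  have h3 := hev wk
  linarith

/-- A `k`-gonal facet has exactly `k` neighbours in the dual facet graph. -/
lemma ncard_neighborSet {k : ℕ} {i : Fin m} (hi : P.IsGon k i) :
    (P.dualGraph.neighborSet i).ncard = k := by
  rw [← hi]
  refine Set.ncard_congr (fun j _ => P.facet i ∩ P.facet j) ?_ ?_ ?_
  · rintro j ⟨hij, e, he, hei, hej⟩
    rw [← eq_inter_facet he hij hei hej]
    exact ⟨he, hei⟩
  · rintro j j' ⟨hij, e, he, hei, hej⟩ ⟨hij', e', he', hei', hej'⟩ heq
    rw [← eq_inter_facet he hij hei hej, ← eq_inter_facet he' hij' hei' hej'] at heq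
    subst heq
    exact facet_unique_of_edge he hij hij' hei hej hej'
  · rintro e ⟨he, hei⟩
    obtain ⟨j, hij, hej⟩ := exists_facet_of_edge he hei
    exact ⟨j, ⟨hij, e, he, hei, hej⟩, (eq_inter_facet he hij hei hej).symm⟩

end Polytope

/-! ### Counting adjacent pairs -/

open Classical in
/-- The number of adjacent pairs with first entry in `S` and second entry in `T`. -/
noncomputable def adjCount {V : Type*} [Fintype V] (G : SimpleGraph V) (S T : Set V) : ℕ :=
  ∑ i with i ∈ S, ∑ j with j ∈ T, if G.Adj i j then 1 else 0

section Counting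

variable {V : Type*} [Fintype V] (G : SimpleGraph V) (S T : Set V)

lemma adjCount_comm : adjCount G S T = adjCount G T S := by
  classical
  simp only [adjCount]
  rw [Finset.sum_comm]
  simp only [G.adj_comm]

lemma adjCount_add_adjCount_compl {d : ℕ} (h : ∀ i ∈ S, (G.neighborSet i).ncard = d) :
    adjCount G S S + adjCount G S Sᶜ = S.ncard * d := by
  classical
  simp only [adjCount]
  rw [← Finset.sum_add_distrib, Set.ncard_eq_toFinset_card', Finset.card_eq_sum_ones,
    Finset.sum_mul]
  refine Finset.sum_congr (by ext; simp) fun i hi => ?_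
  have hs := Finset.sum_filter_add_sum_filter_not Finset.univ (· ∈ S)
    (fun j => if G.Adj i j then 1 else 0)
  simp only [Set.mem_compl_iff]
  rw [hs, one_mul, ← h i (by simpa using hi), Finset.sum_boole, Set.ncard_eq_toFinset_card']
  simp only [Nat.cast_id]
  congr 1
  ext
  simp

lemma sum_ncard_neighborSet_induce [Fintype S] :
    ∑ f : S, ((G.induce S).neighborSet f).ncard = adjCount G S S := by
  classical
  simp only [adjCount]
  rw [Finset.sum_subtype (F := ‹Fintype S›) (p := (· ∈ S)) _ (by simp)]
  refine Finset.sum_congr rfl fun f _ => ?_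
  rw [Finset.sum_subtype (F := ‹Fintype S›) (p := (· ∈ S)) _ (by simp), Finset.sum_boole,
    Set.ncard_eq_toFinset_card']
  simp only [Nat.cast_id]
  congr 1
  ext
  simp

lemma newton_adjMatrix_two [DecidableRel G.Adj] :
    newton (G.adjMatrix ℝ) 2 = ((∑ f, (G.neighborSet f).ncard : ℕ) : ℝ) := by
  classical
  rw [newton, Matrix.trace, Nat.cast_sum]
  refine Finset.sum_congr rfl fun f _ => ?_
  rw [Matrix.diag_apply]
  have hd : (G.neighborSet f).ncard = G.degree f := by
    rw [Set.ncard_eq_toFinset_card', SimpleGraph.degree, SimpleGraph.neighborFinset]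
  rw [hd, ← SimpleGraph.adjMatrix_mul_self_apply_self, pow_two]

end Counting

/-! ### Signature, Newton polynomial and the final count -/

namespace Polytope

variable {m : ℕ} {P : Polytope m}

lemma pentagonSignature_eq : P.pentagonSignature =
    1 / 2 * (adjCount P.dualGraph P.pentagons P.pentagons : ℝ) := by
  classical
  rw [pentagonSignature, ← sum_ncard_neighborSet_induce]
  congr 1
  have hle : ∀ f : P.pentagons, (P.pentagonGraph.neighborSet f).ncard ≤ 5 := by
    intro f
    rw [← ncard_neighborSet f.2]
    refine Set.ncard_le_ncard_of_injOn Subtype.val (fun g hg => hg)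
      Subtype.val_injective.injOn (Set.toFinite _)
  -- Pentagons are grouped by their number of pentagonal neighbours; the class 0, absent from the
  -- signature, contributes nothing.
  have h := Finset.sum_fiberwise_of_maps_to (s := Finset.univ) (t := Finset.range 6)
    (g := fun f : P.pentagons => (P.pentagonGraph.neighborSet f).ncard)
    (fun f _ => Finset.mem_range.2 (Nat.lt_succ_of_le (hle f)))
    (fun f => (P.pentagonGraph.neighborSet f).ncard)
  have h2 : ∀ i, ∑ f : P.pentagons with (P.pentagonGraph.neighborSet f).ncard = i,
      (P.pentagonGraph.neighborSet f).ncard = i * P.pentagonIndex i := by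
    intro i
    rw [Finset.sum_congr rfl (fun f hf => (Finset.mem_filter.1 hf).2), Finset.sum_const,
      pentagonIndex, Set.ncard_eq_toFinset_card', smul_eq_mul, mul_comm]
    congr 2
    ext
    simp
  simp only [h2] at h
  rw [show (∑ f : P.pentagons, ((P.dualGraph.induce P.pentagons).neighborSet f).ncard)
    = _ from h.symm]
  rw [show Finset.Icc 1 5 = {1, 2, 3, 4, 5} from rfl]
  simp [Finset.sum_range_succ]
  ring

lemma newton_hexagonMatrix_two [Fintype P.hexagons] : newton P.hexagonMatrix 2 =
    (adjCount P.dualGraph P.hexagons P.hexagons : ℝ) := by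
  classical
  rw [hexagonMatrix, newton_adjMatrix_two, hexagonGraph, sum_ncard_neighborSet_induce]

lemma IsFullerene.compl_pentagons {n : ℕ} (hP : P.IsFullerene n) : P.pentagonsᶜ = P.hexagons := by
  ext i
  refine ⟨fun h => (hP.pentagon_or_hexagon i).resolve_left h, fun h6 h5 => ?_⟩
  have h := (show P.IsGon 5 i from h5).symm.trans (show P.IsGon 6 i from h6)
  omega

lemma IsFullerene.newton_eq {n : ℕ} [Fintype P.hexagons] (hP : P.IsFullerene n) :
    newton P.hexagonMatrix 2 = 2 * P.pentagonSignature + 3 * (n : ℝ) - 120 := by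
  have h5 := adjCount_add_adjCount_compl P.dualGraph P.pentagons (d := 5)
    fun i hi => ncard_neighborSet hi
  have h6 := adjCount_add_adjCount_compl P.dualGraph P.hexagons (d := 6)
    fun i hi => ncard_neighborSet hi
  rw [← hP.compl_pentagons, compl_compl, hP.compl_pentagons,
    adjCount_comm P.dualGraph P.hexagons P.pentagons] at h6
  rw [hP.compl_pentagons, hP.card_pentagons] at h5
  have hh : (P.hexagons.ncard : ℝ) = n / 2 - 10 := by
    have h := congrArg (Rat.cast (K := ℝ)) hP.card_hexagons
    push_cast at h
    exact h
  rw [newton_hexagonMatrix_two, pentagonSignature_eq]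
  have h5' := congrArg (Nat.cast (R := ℝ)) h5
  have h6' := congrArg (Nat.cast (R := ℝ)) h6
  push_cast at h5' h6'
  linarith

end Polytope

end Fullerene

open Classical in
theorem mainTheorem2 (n m : ℕ) (P : Fullerene.Polytope m) (hP : P.IsFullerene n) :
    P.pentagonSignature = Fullerene.newton P.hexagonMatrix 2 / 2 - 3 * (n : ℝ) / 2 + 60 ∧
      Fullerene.newton P.hexagonMatrix 2 = 2 * P.pentagonSignature + 3 * (n : ℝ) - 120 := by
  have h := hP.newton_eq
  exact ⟨by linarith, h⟩
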